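/- Fix a positive integer $m$ and let $I_k$ be the set of words of length $k\ge 0$ over the alphabet $\{1,\dots,m\}$, $I=\bigcup_{k\ge0} I_k$, and $I_\infty$ the space of infinite words with the product topology. For $\mathbf i\in I_\infty$ write $\mathbf i|k\in I_k$ for its first $k$ letters, and for $\mathbf i\in I_k$ write $|\mathbf i|=k$ and let $C_{\mathbf i}=\{\mathbf j\in I_\infty:\mathbf j|k=\mathbf i\}$ be its cylinder. Let $\{W_{\mathbf i}:\mathbf i\in I\}$ be independent, almost surely strictly positive real random variables on a probability space, not necessarily identically distributed, with $\mathbb E(W_{\mathbf i})=1$ for every $\mathbf i$. Put $$X_{i_1,\dots,i_k}=W_{i_1}W_{i_1,i_2}\cdots W_{i_1,\dots,i_k},\qquad X_\emptyset=1,\qquad \mathcal F_k=\sigma(W_{\mathbf i}:|\mathbf i|\le k).$$ Let $\mu$ be a Borel probability measure on $I_\infty$ and let $q>1$ be real. For $k\ge0$ let $$M_k=\int_{I_\infty}X_{\mathbf i|k}\,d\mu(\mathbf i).$$ Suppose that $$\limsup_{k\to\infty}\Big(\sum_{|\mathbf i|=k}\mathbb E\big((X_{\mathbf i}\,\mu(C_{\mathbf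 i}))^q\big)\Big)^{1/k}<1,$$ where expectations of nonnegative random variables take values in $[0,\infty]$. Then $M_k=\sum_{|\mathbf i|=k}X_{\mathbf i}\,\mu(C_{\mathbf i})$ for every $k$, $(M_k)$ is a martingale with respect to $(\mathcal F_k)$, and $$\limsup_{k\to\infty}\mathbb E\Big(\Big(\int_{I_\infty} X_{\mathbf i|k}\,d\mu(\mathbf i)\Big)^q\Big)=\limsup_{k\to\infty}\mathbb E\Big(\Big(\sum_{|\mathbf i|=k}X_{\mathbf i}\,\mu(C_{\mathbf i})\Big)^q\Big)<\infty,$$ and $\sup_{k}\mathbb E(M_k^q)<\infty$. Moreover there is a random variable $Z\in L^q$ such that $M_k\to Z$ almost surely and in $L^q$ as $k\to\infty$. -/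

import Mathlib

open MeasureTheory ProbabilityTheory Filter Topology

noncomputable section

namespace Cascade

/-- Finite words over the alphabet `Fin m`: pairs of a length `k` and a word of length `k`.
The words of length `k` are the functions `Fin k → Fin m`, and the infinite words are the sequences
`ℕ → Fin m`, whose product topology is that of the metric `m ^ (-|i ∧ j|)`
and whose product σ-algebra is the Borel σ-algebra. -/
abbrev Word (m : ℕ) : Type := Σ k : ℕ, (Fin k → Fin m)

/-- The curtailment after `j` letters of a word of length `k ≥ j`. -/
def curtailWord {m k : ℕ} (i : Fin k → Fin m) (j : ℕ) (hj : j ≤ k) : Fin j → Fin m :=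
  fun r => i (Fin.castLE hj r)

/-- The curtailment `i|k` of an infinite word. -/
def curtail {m : ℕ} (i : ℕ → Fin m) (k : ℕ) : Fin k → Fin m :=
  fun r => i r

/-- The cylinder of all infinite words that begin with `i`. -/
def cylinder {m k : ℕ} (i : Fin k → Fin m) : Set (ℕ → Fin m) :=
  {j | curtail j k = i}

/-- `X_{i₁,…,i_k} = W_{i₁} W_{i₁,i₂} ⋯ W_{i₁,…,i_k}`; the weight of the empty word does not occur. -/
def X {m : ℕ} {Ω : Type*} (W : Word m → Ω → ℝ) {k : ℕ} (i : Fin k → Fin m) (ω : Ω) : ℝ :=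
  ∏ r : Fin k, W ⟨r + 1, curtailWord i (r + 1) r.isLt⟩ ω

/-- The total mass `∫ X_{i|k} dμ(i)` of the random measure of level `k`. -/
def totalMass {m : ℕ} {Ω : Type*} (W : Word m → Ω → ℝ) (μ : Measure (ℕ → Fin m))
    (k : ℕ) (ω : Ω) : ℝ :=
  ∫ i, X W (curtail i k) ω ∂μ

/-- The sum `∑_{|i| = k} X_i μ(C_i)`. -/
def cylinderSum {m : ℕ} {Ω : Type*} (W : Word m → Ω → ℝ) (μ : Measure (ℕ → Fin m))
    (k : ℕ) (ω : Ω) : ℝ :=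
  ∑ i : Fin k → Fin m, X W i ω * μ.real (cylinder i)

/-- The expectation `E(Z ^ q)` of an almost surely nonnegative random variable,
with values in `[0, ∞]`. -/
def moment {Ω : Type*} [MeasurableSpace Ω] (P : Measure Ω) (q : ℝ) (Z : Ω → ℝ) : ENNReal :=
  ∫⁻ ω, ENNReal.ofReal (Z ω ^ q) ∂P

/-- The σ-algebras `F_k = σ(W_i : |i| ≤ k)`. -/
def filtration {m : ℕ} {Ω : Type*} [mΩ : MeasurableSpace Ω] (W : Word m → Ω → ℝ)
    (hW : ∀ i, Measurable (W i)) : Filtration ℕ mΩ where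
  seq k := ⨆ (i : Word m) (_ : i.1 ≤ k), MeasurableSpace.comap (W i) inferInstance
  mono' _ _ hkl := iSup_mono fun _ => iSup_mono' fun hi => ⟨hi.trans hkl, le_rfl⟩
  le' _ := iSup_le fun i => iSup_le fun _ => (hW i).comap_le

end Cascade

end

/-! Everything rests on a uniform bound for E(M_k^q): an L^q-bounded martingale with q > 1 converges
almost surely and in L^q. For the bound, the mass of the cascade below a word u is a sum, over the
children of u, of independent terms of mean at most μ(C_u). For nonnegative independent terms x_i of
mean at most t, any D > 1 admits a C with E((∑ x_i)^q) ≤ D ∑ E(x_i^q) + C t^q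
(`exists_lintegral_sum_rpow_le`). Indeed, either one term dominates and its q-th power is almost
that of the sum, or two terms are comparable and some x_i^(q-1) x_j controls the sum; independence
bounds the mean of that product by E(x_i^(q-1)) t. Put S_k = ∑ E((X_i μ(C_i))^q) over |i| = k.
Descending one level costs a factor D and an error C S_k (`tailMomentSum_succ_le`), so E(M_k^q) ≤
D^k S_k + C ∑_{i<k} D^i S_i (`tailMomentSum_le`). Since S_k decays geometrically, some D > 1 makes ∑
D^k S_k finite. All q > 1 are treated alike, with no case split at 2. -/

open scoped NNReal ENNReal

/-! ### Convergence of L^p-bounded martingales. -/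

section MartingaleConvergence

variable {Ω : Type*} {mΩ : MeasurableSpace Ω} {P : Measure Ω}

/-- The conditional expectations of a function in `L^p`, `1 ≤ p < ∞`, are `p`-uniformly
integrable. -/
lemma MeasureTheory.MemLp.unifIntegrable_condExp [IsProbabilityMeasure P] {ι : Type*}
    {p : ℝ≥0∞} (hp : 1 ≤ p) (hp' : p ≠ ∞) {Z : Ω → ℝ} (hZ : MemLp Z p P) {ℱ : ι → MeasurableSpace Ω}
    (hℱ : ∀ k, ℱ k ≤ mΩ) : UnifIntegrable (fun k => P[Z | ℱ k]) p P := by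
  intro ε hε
  -- Z is split into a bounded simple part, whose conditional expectations keep the bound R, and a
  -- remainder small in L^p, which conditioning does not enlarge.
  have hε2 : 0 < ε / 2 := half_pos hε
  obtain ⟨g, hg, hgp⟩ := hZ.exists_simpleFunc_eLpNorm_sub_lt hp'
    (ε := ENNReal.ofReal (ε / 2)) (by simpa using hε)
  obtain ⟨c, hc⟩ := g.exists_forall_norm_le
  obtain ⟨R, hR⟩ : ∃ R : ℝ≥0, ∀ ω, ‖g ω‖ ≤ R :=
    ⟨c.toNNReal, fun ω => (hc ω).trans (Real.le_coe_toNNReal c)⟩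
  have hgR : ∀ᵐ ω ∂P, ‖g ω‖ ≤ R := ae_of_all _ hR
  have hp0 : p ≠ 0 := (zero_lt_one.trans_le hp).ne'
  have hpr : 0 < p.toReal := ENNReal.toReal_pos hp0 hp'
  -- Chosen so that R * P(s)^(1/p) ≤ ε/2; the 1 in R + 1 only guards against R = 0.
  refine ⟨(ε / 2 / (R + 1)) ^ p.toReal, by positivity, fun k s hs hPs => ?_⟩
  have hsplit : P[Z | ℱ k] =ᵐ[P] P[(g : Ω → ℝ) | ℱ k] + P[Z - (g : Ω → ℝ) | ℱ k] := by
    have h := condExp_add (μ := P) (m := ℱ k) (hgp.integrable hp)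
      ((hZ.sub hgp).integrable hp)
    have h2 : (g : Ω → ℝ) + (Z - g) = Z := by abel
    rwa [h2] at h
  have h1 : eLpNorm (s.indicator (P[(g : Ω → ℝ) | ℱ k])) p P ≤ ENNReal.ofReal (ε / 2) := by
    have hb : ∀ᵐ ω ∂P, ‖P[(g : Ω → ℝ) | ℱ k] ω‖ ≤ R :=
      ae_bdd_abs_condExp_of_ae_bdd_abs (R := (R : ℝ)) hgR
    calc eLpNorm (s.indicator (P[(g : Ω → ℝ) | ℱ k])) p P
        ≤ eLpNorm (s.indicator fun _ => (R : ℝ)) p P := by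
          refine eLpNorm_mono_ae ?_
          filter_upwards [hb] with ω hω
          by_cases h : ω ∈ s <;> simp [h]
          simpa using hω
      _ ≤ ENNReal.ofReal R * ENNReal.ofReal (ε / 2 / (R + 1)) := by
          rw [eLpNorm_indicator_const hs hp0 hp']
          gcongr
          · rw [← ofReal_norm]; simp
          · calc P s ^ (1 / p.toReal)
                ≤ (ENNReal.ofReal ((ε / 2 / (R + 1)) ^ p.toReal)) ^ (1 / p.toReal) := by gcongr
              _ = _ := by
                rw [ENNReal.ofReal_rpow_of_nonneg (by positivity) (by positivity),
                  ← Real.rpow_mul (by positivity), mul_one_div_cancel hpr.ne', Real.rpow_one]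
      _ ≤ _ := by
          rw [← ENNReal.ofReal_mul R.coe_nonneg]
          apply ENNReal.ofReal_le_ofReal
          rw [mul_div_assoc', div_le_iff₀ (by positivity)]
          nlinarith [R.coe_nonneg]
  have h2 : eLpNorm (s.indicator (P[Z - (g : Ω → ℝ) | ℱ k])) p P ≤ ENNReal.ofReal (ε / 2) := by
    have h3 := eLpNorm_condExp_le_eLpNorm (m := ℱ k) (μ := P) (Z - (g : Ω → ℝ)) hp
    refine le_trans ?_ (h3.trans hg.le)
    exact MeasureTheory.eLpNorm_indicator_le (s := s) (P[Z - (g : Ω → ℝ) | ℱ k])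
  calc eLpNorm (s.indicator (P[Z | ℱ k])) p P
      = eLpNorm (s.indicator (P[(g : Ω → ℝ) | ℱ k]) + s.indicator (P[Z - (g : Ω → ℝ) | ℱ k])) p P := by
        refine eLpNorm_congr_ae ?_
        filter_upwards [hsplit] with ω hω
        by_cases h : ω ∈ s <;> simp [h, hω]
    _ ≤ _ := eLpNorm_add_le
        ((stronglyMeasurable_condExp.mono (hℱ k)).indicator hs).aestronglyMeasurable
        ((stronglyMeasurable_condExp.mono (hℱ k)).indicator hs).aestronglyMeasurable hp
    _ ≤ ENNReal.ofReal (ε / 2) + ENNReal.ofReal (ε / 2) := add_le_add h1 h2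
    _ = ENNReal.ofReal ε := by rw [← ENNReal.ofReal_add hε2.le hε2.le, add_halves]

/-- A sequence bounded in `L^p`, `p > 1`, is uniformly integrable. -/
lemma unifIntegrable_one_of_eLpNorm_bdd {ι : Type*} {p : ℝ≥0∞} (hp : 1 < p) (hp' : p ≠ ∞)
    {f : ι → Ω → ℝ} (hf : ∀ k, AEStronglyMeasurable (f k) P) {R : ℝ≥0}
    (hR : ∀ k, eLpNorm (f k) p P ≤ R) : UnifIntegrable f 1 P := by
  intro ε hε
  have hpr : 1 < p.toReal := by
    rw [← ENNReal.toReal_one]; exact ENNReal.toReal_strict_mono hp' hp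
  set e : ℝ := 1 - 1 / p.toReal with he
  have he0 : 0 < e := by
    rw [he, sub_pos, div_lt_one (by linarith)]; exact hpr
  refine ⟨(ε / (R + 1)) ^ (1 / e), by positivity, fun k s hs hPs => ?_⟩
  rw [eLpNorm_indicator_eq_eLpNorm_restrict hs]
  -- Hölder on s: the L^1 norm is at most the L^p norm times P(s)^(1 - 1/p).
  refine (eLpNorm_le_eLpNorm_mul_rpow_measure_univ hp.le (hf k).restrict).trans ?_
  calc eLpNorm (f k) p (P.restrict s) *
        (P.restrict s) Set.univ ^ (1 / (1 : ℝ≥0∞).toReal - 1 / p.toReal)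
      ≤ R * ENNReal.ofReal (ε / (R + 1)) := by
        gcongr
        · exact (eLpNorm_mono_measure _ Measure.restrict_le_self).trans (hR k)
        · rw [Measure.restrict_apply_univ, ENNReal.toReal_one, div_one (1 : ℝ), ← he]
          calc P s ^ e ≤ ENNReal.ofReal ((ε / (R + 1)) ^ (1 / e)) ^ e := by gcongr
            _ = _ := by
              rw [ENNReal.ofReal_rpow_of_nonneg (by positivity) he0.le,
                ← Real.rpow_mul (by positivity), one_div_mul_cancel he0.ne', Real.rpow_one]
    _ ≤ ENNReal.ofReal ε := by
        rw [← ENNReal.ofReal_coe_nnreal, ← ENNReal.ofReal_mul R.coe_nonneg]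
        apply ENNReal.ofReal_le_ofReal
        rw [mul_div_assoc', div_le_iff₀ (by positivity)]
        nlinarith [R.coe_nonneg]

/-- **`L^p` martingale convergence theorem**. -/
lemma MeasureTheory.Martingale.exists_tendsto_of_eLpNorm_bdd [IsProbabilityMeasure P] {p : ℝ≥0∞}
    (hp : 1 < p) (hp' : p ≠ ∞) {ℱ : Filtration ℕ mΩ} {f : ℕ → Ω → ℝ} (hf : Martingale f ℱ P)
    {R : ℝ≥0} (hR : ∀ k, eLpNorm (f k) p P ≤ R) :
    ∃ Z : Ω → ℝ, MemLp Z p P ∧ (∀ᵐ ω ∂P, Tendsto (fun k => f k ω) atTop (𝓝 (Z ω))) ∧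
      Tendsto (fun k => eLpNorm (f k - Z) p P) atTop (𝓝 0) := by
  have hmeas : ∀ k, AEStronglyMeasurable (f k) P := fun k =>
    ((hf.1 k).mono (ℱ.le k)).aestronglyMeasurable
  have hR1 : ∀ k, eLpNorm (f k) 1 P ≤ R := fun k =>
    (eLpNorm_le_eLpNorm_of_exponent_le hp.le (hmeas k)).trans (hR k)
  have hUI : UniformIntegrable f 1 P :=
    ⟨hmeas, unifIntegrable_one_of_eLpNorm_bdd hp hp' hmeas hR, R, hR1⟩
  obtain ⟨Z, hZ, hae, hce⟩ : ∃ Z : Ω → ℝ, MemLp Z p P ∧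
      (∀ᵐ ω ∂P, Tendsto (fun k => f k ω) atTop (𝓝 (Z ω))) ∧ ∀ k, f k =ᵐ[P] P[Z | ℱ k] :=
    ⟨_, hf.submartingale.memLp_limitProcess hR, hf.submartingale.ae_tendsto_limitProcess hR1,
      hf.ae_eq_condExp_limitProcess hUI⟩
  -- The martingale is closed by its limit, so p-uniform integrability passes to it from the
  -- conditional expectations of Z; Vitali's theorem then gives L^p convergence.
  have hUIp : UnifIntegrable f p P :=
    (unifIntegrable_congr_ae hce).2 (hZ.unifIntegrable_condExp hp.le hp' ℱ.le)
  exact ⟨Z, hZ, hae, tendsto_Lp_finite_of_tendsto_ae hp.le hp' hmeas hZ hUIp hae⟩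

end MartingaleConvergence

/-! ### Moments of sums of independent nonnegative variables. -/

section MomentInequality

lemma ENNReal.rpow_sub_one_mul_self {q : ℝ} (hq : 1 < q) (x : ℝ≥0∞) :
    x ^ (q - 1) * x = x ^ q := by
  have h := ENNReal.rpow_add_of_nonneg (x := x) (q - 1) 1 (by linarith) zero_le_one
  rw [ENNReal.rpow_one, sub_add_cancel] at h
  exact h.symm

/-- A Young inequality with small coefficient δ: if t ≤ δx the first term suffices, and otherwise x
≤ t/δ lets the second one take over. -/
lemma ENNReal.exists_rpow_sub_one_mul_le {q : ℝ} (hq : 1 < q) {δ : ℝ≥0} (hδ : 0 < δ) :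
    ∃ C : ℝ≥0, ∀ x t : ℝ≥0∞, x ^ (q - 1) * t ≤ δ * x ^ q + C * t ^ q := by
  refine ⟨δ⁻¹ ^ (q - 1), fun x t => ?_⟩
  have hq1 : 0 ≤ q - 1 := by linarith
  rcases le_total t (δ * x) with h | h
  · refine le_add_right ?_
    calc x ^ (q - 1) * t ≤ x ^ (q - 1) * (δ * x) := by gcongr
      _ = δ * x ^ q := by rw [← ENNReal.rpow_sub_one_mul_self hq]; ring
  · refine le_add_left ?_
    have hx : x ≤ (δ⁻¹ : ℝ≥0) * t := by
      calc x = ((δ⁻¹ * δ : ℝ≥0) : ℝ≥0∞) * x := by rw [inv_mul_cancel₀ hδ.ne']; simp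
        _ = (δ⁻¹ : ℝ≥0) * (δ * x) := by rw [ENNReal.coe_mul, mul_assoc]
        _ ≤ _ := by gcongr
    calc x ^ (q - 1) * t ≤ ((δ⁻¹ : ℝ≥0) * t) ^ (q - 1) * t := by gcongr
      _ = _ := by
        rw [ENNReal.mul_rpow_of_nonneg _ _ hq1, mul_assoc, ENNReal.rpow_sub_one_mul_self hq,
          ENNReal.coe_rpow_of_nonneg _ hq1]

/-- Let x i be the largest term. If all others are at most η * x i, the sum is at most (1 + Nη) x i;
if some x j exceeds η * x i, one factor x i of (N x i)^q may be traded for x j / η. -/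
lemma ENNReal.exists_sum_rpow_le {ι : Type*} [Fintype ι] [DecidableEq ι] {q : ℝ} (hq : 1 < q)
    {D : ℝ≥0} (hD : 1 < D) :
    ∃ C : ℝ≥0, ∀ x : ι → ℝ≥0∞, (∑ i, x i) ^ q ≤
      D * ∑ i, x i ^ q + C * ∑ i, ∑ j ∈ Finset.univ.erase i, x i ^ (q - 1) * x j := by
  have hq0 : 0 < q := by linarith
  obtain ⟨N, hN⟩ : ∃ N : ℕ, N = Fintype.card ι := ⟨_, rfl⟩
  -- Makes 1 + Nη ≤ D^(1/q); the denominator N + 1 stays positive for an empty index type.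
  set η : ℝ≥0 := (D ^ (1 / q) - 1) / (N + 1) with hη
  have hDq : 1 < D ^ (1 / q) := NNReal.one_lt_rpow hD (by positivity)
  have hη0 : 0 < η := div_pos (tsub_pos_of_lt hDq) (by positivity)
  have hηD : (1 + N * η) ^ q ≤ D := by
    have h1 : 1 + N * η ≤ D ^ (1 / q) := by
      have h2 : N * η ≤ D ^ (1 / q) - 1 := by
        rw [hη, mul_div_assoc', div_le_iff₀ (by positivity), mul_comm]
        gcongr
        simp
      calc 1 + N * η ≤ 1 + (D ^ (1 / q) - 1) := by gcongr
        _ = _ := add_tsub_cancel_of_le hDq.le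
    calc (1 + N * η) ^ q ≤ (D ^ (1 / q)) ^ q := by gcongr
      _ = D := by rw [← NNReal.rpow_mul, one_div_mul_cancel hq0.ne', NNReal.rpow_one]
  refine ⟨(N : ℝ≥0) ^ q * η⁻¹, fun x => ?_⟩
  rcases isEmpty_or_nonempty ι with hι | hι
  · simp [hq0]
  obtain ⟨i, -, hi⟩ := Finset.exists_max_image Finset.univ x Finset.univ_nonempty
  by_cases h : ∀ j ∈ Finset.univ.erase i, x j ≤ η * x i
  · refine le_add_right ?_
    have hS : ∑ j, x j ≤ ((1 + N * η : ℝ≥0) : ℝ≥0∞) * x i := by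
      rw [← Finset.add_sum_erase _ _ (Finset.mem_univ i)]
      calc x i + ∑ j ∈ Finset.univ.erase i, x j
          ≤ x i + ∑ j ∈ Finset.univ.erase i, η * x i := by
            gcongr with j hj; exact h j hj
        _ ≤ x i + ∑ j : ι, η * x i := by
            gcongr; exact Finset.subset_univ _
        _ = _ := by simp [hN, Finset.card_univ]; ring
    calc (∑ j, x j) ^ q ≤ (((1 + N * η : ℝ≥0) : ℝ≥0∞) * x i) ^ q := by gcongr
      _ = (((1 + N * η) ^ q : ℝ≥0) : ℝ≥0∞) * x i ^ q := by
        rw [ENNReal.mul_rpow_of_nonneg _ _ hq0.le, ENNReal.coe_rpow_of_nonneg _ hq0.le]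
      _ ≤ D * ∑ i, x i ^ q := by
        gcongr
        exact Finset.single_le_sum (f := fun i => x i ^ q) (fun _ _ => zero_le)
          (Finset.mem_univ i)
  · push Not at h
    obtain ⟨j, hj, hij⟩ := h
    refine le_add_left ?_
    have hx : x i ≤ (η⁻¹ : ℝ≥0) * x j := by
      calc x i = ((η⁻¹ * η : ℝ≥0) : ℝ≥0∞) * x i := by rw [inv_mul_cancel₀ hη0.ne']; simp
        _ = (η⁻¹ : ℝ≥0) * (η * x i) := by rw [ENNReal.coe_mul, mul_assoc]
        _ ≤ _ := by gcongr
    have hS : ∑ j, x j ≤ N * x i := by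
      refine (Finset.sum_le_card_nsmul _ _ (x i) fun j _ => hi j (Finset.mem_univ j)).trans ?_
      simp [hN, Finset.card_univ]
    calc (∑ j, x j) ^ q ≤ (N * x i) ^ q := by gcongr
      _ = ((N : ℝ≥0) ^ q : ℝ≥0) * (x i ^ (q - 1) * x i) := by
        rw [ENNReal.mul_rpow_of_nonneg _ _ hq0.le, ENNReal.coe_rpow_of_nonneg _ hq0.le,
          ENNReal.rpow_sub_one_mul_self hq, ENNReal.coe_natCast]
      _ ≤ ((N : ℝ≥0) ^ q : ℝ≥0) * (x i ^ (q - 1) * ((η⁻¹ : ℝ≥0) * x j)) := by gcongr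
      _ = (((N : ℝ≥0) ^ q * η⁻¹ : ℝ≥0) : ℝ≥0∞) * (x i ^ (q - 1) * x j) := by
        rw [ENNReal.coe_mul]; ring
      _ ≤ _ := by
        gcongr
        refine le_trans ?_ (Finset.single_le_sum
          (f := fun i => ∑ j ∈ Finset.univ.erase i, x i ^ (q - 1) * x j)
          (fun _ _ => zero_le) (Finset.mem_univ i))
        exact Finset.single_le_sum (f := fun j => x i ^ (q - 1) * x j)
          (fun _ _ => zero_le) hj

/-- The `q`-th moment of a sum of pairwise independent nonnegative random variables whose means
are at most `t`. -/
lemma exists_lintegral_sum_rpow_le {Ω ι : Type*} [MeasurableSpace Ω] (P : Measure Ω) [Fintype ι]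
    [DecidableEq ι] {q : ℝ} (hq : 1 < q) {D : ℝ≥0} (hD : 1 < D) [IsProbabilityMeasure P] :
    ∃ C : ℝ≥0, ∀ x : ι → Ω → ℝ≥0∞, (∀ i, Measurable (x i)) →
      (∀ i j, i ≠ j → IndepFun (x i) (x j) P) → ∀ t : ℝ≥0∞, (∀ i, ∫⁻ ω, x i ω ∂P ≤ t) →
      ∫⁻ ω, (∑ i, x i ω) ^ q ∂P ≤ D * ∑ i, ∫⁻ ω, x i ω ^ q ∂P + C * t ^ q := by
  obtain ⟨D₀, hD₀, hDD⟩ := exists_between hD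
  obtain ⟨C₀, hC₀⟩ := ENNReal.exists_sum_rpow_le (ι := ι) hq hD₀
  obtain ⟨N, hN⟩ : ∃ N : ℕ, N = Fintype.card ι := ⟨_, rfl⟩
  -- The gap D - D₀ absorbs the multiples of E(x_i^q) that come from the cross terms, at most N for
  -- each i.
  set δ : ℝ≥0 := (D - D₀) / (C₀ * N + 1) with hδ
  have hδ0 : 0 < δ := div_pos (tsub_pos_of_lt hDD) (by positivity)
  have hδD : D₀ + C₀ * N * δ ≤ D := by
    have h2 : C₀ * N * δ ≤ D - D₀ := by
      rw [hδ, mul_div_assoc', div_le_iff₀ (by positivity), mul_comm]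
      gcongr
      simp
    calc D₀ + C₀ * N * δ ≤ D₀ + (D - D₀) := by gcongr
      _ = _ := add_tsub_cancel_of_le hDD.le
  obtain ⟨C₁, hC₁⟩ := ENNReal.exists_rpow_sub_one_mul_le hq hδ0
  refine ⟨C₀ * N * N * C₁, fun x hx hind t ht => ?_⟩
  have hcross : ∀ i, ∀ j ∈ Finset.univ.erase i, ∫⁻ ω, x i ω ^ (q - 1) * x j ω ∂P ≤
      δ * ∫⁻ ω, x i ω ^ q ∂P + C₁ * t ^ q := by
    intro i j hj
    have hij : i ≠ j := (Finset.ne_of_mem_erase hj).symm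
    have hI : IndepFun (fun ω => x i ω ^ (q - 1)) (x j) P :=
      (hind i j hij).comp (φ := fun y : ℝ≥0∞ => y ^ (q - 1)) (ψ := id)
        (by fun_prop) measurable_id
    calc ∫⁻ ω, x i ω ^ (q - 1) * x j ω ∂P
        = (∫⁻ ω, x i ω ^ (q - 1) ∂P) * ∫⁻ ω, x j ω ∂P :=
          lintegral_mul_eq_lintegral_mul_lintegral_of_indepFun ((hx i).pow_const _) (hx j) hI
      _ ≤ (∫⁻ ω, x i ω ^ (q - 1) ∂P) * t := by gcongr; exact ht j
      -- The constant t goes back under the integral so that the Young inequality applies pointwise.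
      _ = ∫⁻ ω, x i ω ^ (q - 1) * t ∂P := (lintegral_mul_const _ ((hx i).pow_const _)).symm
      _ ≤ ∫⁻ ω, (δ * x i ω ^ q + C₁ * t ^ q) ∂P := lintegral_mono fun ω => hC₁ _ _
      _ = _ := by
        rw [lintegral_add_right _ measurable_const, lintegral_const,
          lintegral_const_mul _ ((hx i).pow_const _), measure_univ, mul_one]
  have hmeas : ∀ i j, Measurable fun ω => x i ω ^ (q - 1) * x j ω := fun i j =>
    ((hx i).pow_const _).mul (hx j)
  calc ∫⁻ ω, (∑ i, x i ω) ^ q ∂P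
      ≤ ∫⁻ ω, (D₀ * ∑ i, x i ω ^ q +
          C₀ * ∑ i, ∑ j ∈ Finset.univ.erase i, x i ω ^ (q - 1) * x j ω) ∂P :=
        lintegral_mono fun ω => hC₀ _
    _ = D₀ * ∑ i, ∫⁻ ω, x i ω ^ q ∂P +
          C₀ * ∑ i, ∑ j ∈ Finset.univ.erase i, ∫⁻ ω, x i ω ^ (q - 1) * x j ω ∂P := by
        have h1 : Measurable fun ω => ∑ i, x i ω ^ q :=
          Finset.measurable_sum _ fun i _ => (hx i).pow_const _
        have h2 : ∀ i, Measurable fun ω => ∑ j ∈ Finset.univ.erase i, x i ω ^ (q - 1) * x j ω :=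
          fun i => Finset.measurable_sum _ fun j _ => hmeas i j
        rw [lintegral_add_left (h1.const_mul _), lintegral_const_mul _ h1,
          lintegral_const_mul _ (Finset.measurable_sum _ fun i _ => h2 i),
          lintegral_finsetSum _ fun i _ => (hx i).pow_const _,
          lintegral_finsetSum _ fun i _ => h2 i]
        congr 3 with i
        exact lintegral_finsetSum _ fun j _ => hmeas i j
    _ ≤ D₀ * ∑ i, ∫⁻ ω, x i ω ^ q ∂P +
          C₀ * ∑ i, ∑ _j : ι, (δ * ∫⁻ ω, x i ω ^ q ∂P + C₁ * t ^ q) := by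
        gcongr with i
        exact (Finset.sum_le_sum (hcross i)).trans
          (Finset.sum_le_sum_of_subset (Finset.subset_univ _))
    _ = ((D₀ + C₀ * N * δ : ℝ≥0) : ℝ≥0∞) * ∑ i, ∫⁻ ω, x i ω ^ q ∂P +
          ((C₀ * N * N * C₁ : ℝ≥0) : ℝ≥0∞) * t ^ q := by
        simp only [Finset.sum_const, Finset.card_univ, ← hN, nsmul_eq_mul, ← Finset.mul_sum,
          Finset.sum_add_distrib, ENNReal.coe_add, ENNReal.coe_mul, ENNReal.coe_natCast]
        ring
    _ ≤ _ := by gcongr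

end MomentInequality

namespace Cascade

/-! ### Words and their extensions. -/

section Words

variable {m : ℕ}

/-- The word `u` followed by the letter `a`. -/
def append {k : ℕ} (u : Fin k → Fin m) (a : Fin m) : Fin (k + 1) → Fin m :=
  Fin.snoc (α := fun _ => Fin m) u a

lemma curtailWord_append {k j : ℕ} (u : Fin k → Fin m) (a : Fin m) (hj : j ≤ k) :
    curtailWord (append u a) j (hj.trans k.le_succ) = curtailWord u j hj := by
  funext r
  exact Fin.snoc_castSucc (α := fun _ => Fin m) a u (Fin.castLE hj r)

lemma curtailWord_curtailWord {k j i : ℕ} (u : Fin k → Fin m) (hj : j ≤ k) (hi : i ≤ j) :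
    curtailWord (curtailWord u j hj) i hi = curtailWord u i (hi.trans hj) := rfl

lemma append_injective {k : ℕ} (u : Fin k → Fin m) : Function.Injective (append u) := by
  intro a b h
  have := congrFun h (Fin.last k)
  simpa [append] using this

lemma sum_append {M : Type*} [AddCommMonoid M] {k : ℕ} (f : (Fin (k + 1) → Fin m) → M) :
    ∑ v, f v = ∑ u : Fin k → Fin m, ∑ a, f (append u a) := by
  rw [← (Fin.snocEquiv fun _ : Fin (k + 1) => Fin m).sum_comp, Fintype.sum_prod_type,
    Finset.sum_comm]
  rfl

/-- Stated for a general commutative monoid to serve both the real weights and the `ℝ≥0∞`-valued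
ones. -/
lemma prod_append {M : Type*} [CommMonoid M] {k : ℕ} (V : Word m → M) (u : Fin k → Fin m)
    (a : Fin m) :
    ∏ r : Fin (k + 1), V ⟨r + 1, curtailWord (append u a) (r + 1) r.isLt⟩ =
      (∏ r : Fin k, V ⟨r + 1, curtailWord u (r + 1) r.isLt⟩) * V ⟨k + 1, append u a⟩ := by
  rw [Fin.prod_univ_castSucc]
  congr 1
  refine Finset.prod_congr rfl fun r _ => ?_
  exact congrArg (fun w => V ⟨r + 1, w⟩) (curtailWord_append u a r.isLt)

/-- The words that begin with `u`. -/
def extensions {k : ℕ} (u : Fin k → Fin m) : Set (Word m) :=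
  {w | ∃ h : k ≤ w.1, curtailWord w.2 k h = u}

/-- The words longer than `u` that begin with `u`. -/
def properExtensions {k : ℕ} (u : Fin k → Fin m) : Set (Word m) :=
  {w | ∃ h : k < w.1, curtailWord w.2 k h.le = u}

lemma mem_extensions_self {k : ℕ} (u : Fin k → Fin m) : (⟨k, u⟩ : Word m) ∈ extensions u :=
  ⟨le_rfl, rfl⟩

lemma properExtensions_subset {k : ℕ} (u : Fin k → Fin m) :
    properExtensions u ⊆ extensions u := fun _ ⟨h, hw⟩ => ⟨h.le, hw⟩

lemma extensions_append_subset {k : ℕ} (u : Fin k → Fin m) (a : Fin m) :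
    extensions (append u a) ⊆ properExtensions u := by
  rintro w ⟨h, hw⟩
  refine ⟨h, ?_⟩
  rw [← curtailWord_curtailWord w.2 h k.le_succ, hw]
  exact curtailWord_append u a le_rfl

lemma disjoint_singleton_properExtensions {k : ℕ} (u : Fin k → Fin m) :
    Disjoint {(⟨k, u⟩ : Word m)} (properExtensions u) := by
  rw [Set.disjoint_singleton_left]
  rintro ⟨h, -⟩
  exact lt_irrefl _ h

lemma disjoint_extensions {k : ℕ} {u v : Fin k → Fin m} (huv : u ≠ v) :
    Disjoint (extensions u) (extensions v) := by
  rw [Set.disjoint_left]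
  rintro w ⟨h, hw⟩ ⟨_, hw'⟩
  exact huv (hw.symm.trans hw')

end Words

/-! ### Cylinders and their measures. -/

section Cylinders

variable {m : ℕ}

lemma measurable_curtail (k : ℕ) : Measurable fun i : ℕ → Fin m => curtail i k :=
  measurable_pi_lambda _ fun r => measurable_pi_apply (r : ℕ)

lemma measurableSet_cylinder {k : ℕ} (u : Fin k → Fin m) : MeasurableSet (cylinder u) :=
  measurable_curtail k (measurableSet_singleton u)

lemma cylinder_append {k : ℕ} (u : Fin k → Fin m) (a : Fin m) :
    cylinder (append u a) = {j | curtail j k = u ∧ j k = a} := by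
  ext j
  constructor
  · intro h
    have h' : curtail j (k + 1) = append u a := h
    refine ⟨?_, ?_⟩
    · funext r
      have := congrFun h' r.castSucc
      simpa [append, curtail] using this
    · have := congrFun h' (Fin.last k)
      simpa [append, curtail] using this
  · rintro ⟨h, h'⟩
    funext r
    refine Fin.lastCases ?_ (fun r => ?_) r
    · simpa [append, curtail] using h'
    · simpa [append, curtail] using congrFun h r

lemma measure_cylinder_eq_sum (μ : Measure (ℕ → Fin m)) {k : ℕ} (u : Fin k → Fin m) :
    μ (cylinder u) = ∑ a, μ (cylinder (append u a)) := by
  have h : cylinder u = ⋃ a ∈ (Finset.univ : Finset (Fin m)), cylinder (append u a) := by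
    ext j
    simp only [cylinder_append, Set.mem_iUnion, Set.mem_ofPred_eq]
    simp [cylinder]
  rw [h, measure_biUnion_finset]
  · intro a _ b _ hab
    rw [Function.onFun, Set.disjoint_left]
    intro j hj hj'
    rw [cylinder_append] at hj hj'
    exact hab (hj.2.symm.trans hj'.2)
  · exact fun a _ => measurableSet_cylinder _

lemma measure_cylinder_append_le (μ : Measure (ℕ → Fin m)) {k : ℕ} (u : Fin k → Fin m)
    (a : Fin m) : μ (cylinder (append u a)) ≤ μ (cylinder u) :=
  measure_mono fun j hj => by rw [cylinder_append] at hj; exact hj.1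

lemma integral_curtail (μ : Measure (ℕ → Fin m)) [IsProbabilityMeasure μ] {k : ℕ}
    (f : (Fin k → Fin m) → ℝ) :
    ∫ i, f (curtail i k) ∂μ = ∑ u, f u * μ.real (cylinder u) := by
  have hf : AEStronglyMeasurable f (μ.map fun i => curtail i k) :=
    (measurable_of_finite f).aestronglyMeasurable
  rw [← integral_map (measurable_curtail k).aemeasurable hf,
    integral_fintype (Integrable.of_finite)]
  refine Finset.sum_congr rfl fun u _ => ?_
  rw [map_measureReal_apply (measurable_curtail k) (measurableSet_singleton u), smul_eq_mul,
    mul_comm]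
  rfl

end Cylinders

/-! ### Recursion for the moments of the cascade. -/

section Moments

variable {m : ℕ} {Ω : Type*} (V : Word m → Ω → ℝ≥0∞)

/-- The `[0, ∞]`-valued weight of a word. -/
noncomputable def weight {k : ℕ} (u : Fin k → Fin m) (ω : Ω) : ℝ≥0∞ :=
  ∏ r : Fin k, V ⟨r + 1, curtailWord u (r + 1) r.isLt⟩ ω

/-- The mass, `l` levels below the word `u`, of the cascade that starts at `u`. -/
noncomputable def tailMass (μ : Measure (ℕ → Fin m)) : ∀ (_ : ℕ) {k : ℕ} (_ : Fin k → Fin m), Ω → ℝ≥0∞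
  | 0, _, u => fun _ => μ (cylinder u)
  | l + 1, k, u => fun ω =>
      ∑ a, V ⟨k + 1, append u a⟩ ω * tailMass μ l (append u a) ω

lemma weight_append {k : ℕ} (u : Fin k → Fin m) (a : Fin m) (ω : Ω) :
    weight V (append u a) ω = weight V u ω * V ⟨k + 1, append u a⟩ ω :=
  prod_append (fun w => V w ω) u a

/-- Splits the mass of level n at level k. The separate variable n avoids transporting words between
lengths k + 1 + l and k + (l + 1). -/
lemma sum_weight_mul_tailMass (μ : Measure (ℕ → Fin m)) {l k n : ℕ} (hn : k + l = n) (ω : Ω) :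
    ∑ u : Fin k → Fin m, weight V u ω * tailMass V μ l u ω =
      ∑ v : Fin n → Fin m, weight V v ω * μ (cylinder v) := by
  induction l generalizing k with
  | zero => subst hn; rfl
  | succ l ih =>
    rw [← ih (k := k + 1) (by omega), sum_append]
    refine Finset.sum_congr rfl fun u _ => ?_
    simp only [tailMass, weight_append, Finset.mul_sum, mul_assoc]

/-- Records which weights the tail depends on, so that independence reduces to disjointness of sets
of words. -/
lemma measurable_tailMass_iSup (μ : Measure (ℕ → Fin m)) (l : ℕ) {k : ℕ} (u : Fin k → Fin m) :
    Measurable[⨆ w ∈ properExtensions u, MeasurableSpace.comap (V w) inferInstance]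
      (tailMass V μ l u) := by
  induction l generalizing k with
  | zero => exact measurable_const
  | succ l ih =>
    refine Finset.measurable_sum _ fun a _ => ?_
    have hsub := extensions_append_subset u a
    refine Measurable.mul ?_ ?_
    · exact (comap_measurable (V ⟨k + 1, append u a⟩)).mono
        (le_biSup (fun w => MeasurableSpace.comap (V w) inferInstance)
          (hsub (mem_extensions_self _))) le_rfl
    · exact (ih (append u a)).mono
        (biSup_mono fun w hw => hsub (properExtensions_subset _ hw)) le_rfl

lemma measurable_mul_tailMass_iSup (μ : Measure (ℕ → Fin m)) (l : ℕ) {k : ℕ}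
    (u : Fin k → Fin m) :
    Measurable[⨆ w ∈ extensions u, MeasurableSpace.comap (V w) inferInstance]
      (fun ω => V ⟨k, u⟩ ω * tailMass V μ l u ω) := by
  refine Measurable.mul ?_ ?_
  · exact (comap_measurable (V ⟨k, u⟩)).mono
      (le_biSup (fun w => MeasurableSpace.comap (V w) inferInstance)
        (mem_extensions_self _)) le_rfl
  · exact (measurable_tailMass_iSup V μ l u).mono
      (biSup_mono fun w hw => properExtensions_subset _ hw) le_rfl

lemma measurable_weight_iSup {k : ℕ} (u : Fin k → Fin m) :
    Measurable[⨆ w ∈ {w : Word m | w.1 ≤ k}, MeasurableSpace.comap (V w) inferInstance]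
      (weight V u) := by
  refine Finset.measurable_prod _ fun r _ => ?_
  have hr : (⟨r + 1, curtailWord u (r + 1) r.isLt⟩ : Word m) ∈ {w : Word m | w.1 ≤ k} := r.isLt
  exact (comap_measurable (V ⟨r + 1, curtailWord u (r + 1) r.isLt⟩)).mono
    (le_biSup (fun w => MeasurableSpace.comap (V w) inferInstance) hr) le_rfl

variable {V} [mΩ : MeasurableSpace Ω] {P : Measure Ω}

lemma indep_iSup_comap {β : Type*} [MeasurableSpace β] {V : Word m → Ω → β}
    (hV : ∀ w, Measurable (V w)) (hind : iIndepFun V P) {S T : Set (Word m)}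
    (hST : Disjoint S T) :
    Indep (⨆ w ∈ S, MeasurableSpace.comap (V w) inferInstance)
      (⨆ w ∈ T, MeasurableSpace.comap (V w) inferInstance) P :=
  indep_iSup_of_disjoint (fun w => (hV w).comap_le) hind hST

lemma indep_iSup_comap_of_length_le {β : Type*} [MeasurableSpace β] {V : Word m → Ω → β}
    (hV : ∀ w, Measurable (V w)) (hind : iIndepFun V P) {k : ℕ} (v : Fin (k + 1) → Fin m) :
    Indep (⨆ w ∈ {w : Word m | w.1 ≤ k}, MeasurableSpace.comap (V w) inferInstance)
      (MeasurableSpace.comap (V ⟨k + 1, v⟩) inferInstance) P := by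
  have hd : Disjoint {w : Word m | w.1 ≤ k} {(⟨k + 1, v⟩ : Word m)} := by
    rw [Set.disjoint_singleton_right]
    exact Nat.not_succ_le_self k
  have h := indep_iSup_comap hV hind hd
  rwa [iSup_singleton] at h

lemma iSup_comap_le (hV : ∀ w, Measurable (V w)) (S : Set (Word m)) :
    ⨆ w ∈ S, MeasurableSpace.comap (V w) inferInstance ≤ mΩ :=
  iSup₂_le fun w _ => (hV w).comap_le

lemma measurable_tailMass (hV : ∀ w, Measurable (V w)) (μ : Measure (ℕ → Fin m)) (l : ℕ) {k : ℕ}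
    (u : Fin k → Fin m) : Measurable (tailMass V μ l u) :=
  (measurable_tailMass_iSup V μ l u).mono (iSup_comap_le hV _) le_rfl

lemma measurable_weight (hV : ∀ w, Measurable (V w)) {k : ℕ} (u : Fin k → Fin m) :
    Measurable (weight V u) :=
  (measurable_weight_iSup V u).mono (iSup_comap_le hV _) le_rfl

lemma indepFun_tailMass (hV : ∀ w, Measurable (V w)) (hind : iIndepFun V P)
    (μ : Measure (ℕ → Fin m)) (l : ℕ) {k : ℕ} (u : Fin k → Fin m) :
    IndepFun (V ⟨k, u⟩) (tailMass V μ l u) P := by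
  have h := indep_iSup_comap hV hind (disjoint_singleton_properExtensions u)
  rw [iSup_singleton] at h
  exact indep_of_indep_of_le_right h (measurable_tailMass_iSup V μ l u).comap_le

lemma indepFun_mul_tailMass (hV : ∀ w, Measurable (V w)) (hind : iIndepFun V P)
    (μ : Measure (ℕ → Fin m)) (l : ℕ) {k : ℕ} {u v : Fin k → Fin m} (huv : u ≠ v) :
    IndepFun (fun ω => V ⟨k, u⟩ ω * tailMass V μ l u ω)
      (fun ω => V ⟨k, v⟩ ω * tailMass V μ l v ω) P :=
  indep_of_indep_of_le_right (indep_of_indep_of_le_left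
    (indep_iSup_comap hV hind (disjoint_extensions huv))
    (measurable_mul_tailMass_iSup V μ l u).comap_le)
    (measurable_mul_tailMass_iSup V μ l v).comap_le

lemma indepFun_weight (hV : ∀ w, Measurable (V w)) (hind : iIndepFun V P)
    {k : ℕ} (u : Fin k → Fin m) (v : Fin (k + 1) → Fin m) :
    IndepFun (weight V u) (V ⟨k + 1, v⟩) P :=
  indep_of_indep_of_le_left (indep_iSup_comap_of_length_le hV hind v)
    (measurable_weight_iSup V u).comap_le

lemma lintegral_mul_rpow_of_indepFun {f g : Ω → ℝ≥0∞} (hf : Measurable f) (hg : Measurable g)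
    (h : IndepFun f g P) {q : ℝ} (hq : 0 ≤ q) :
    ∫⁻ ω, (f ω * g ω) ^ q ∂P = (∫⁻ ω, f ω ^ q ∂P) * ∫⁻ ω, g ω ^ q ∂P := by
  simp_rw [ENNReal.mul_rpow_of_nonneg _ _ hq]
  exact lintegral_mul_eq_lintegral_mul_lintegral_of_indepFun (hf.pow_const q) (hg.pow_const q)
    (h.comp (φ := fun y : ℝ≥0∞ => y ^ q) (ψ := fun y : ℝ≥0∞ => y ^ q) (by fun_prop) (by fun_prop))

lemma lintegral_tailMass (hV : ∀ w, Measurable (V w)) (hind : iIndepFun V P)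
    [IsProbabilityMeasure P] (hmean : ∀ w, ∫⁻ ω, V w ω ∂P = 1)
    (μ : Measure (ℕ → Fin m)) (l : ℕ) {k : ℕ} (u : Fin k → Fin m) :
    ∫⁻ ω, tailMass V μ l u ω ∂P = μ (cylinder u) := by
  induction l generalizing k with
  | zero => simp [tailMass]
  | succ l ih =>
    simp only [tailMass]
    rw [lintegral_finsetSum, measure_cylinder_eq_sum]
    swap
    · exact fun a _ => (hV _).mul (measurable_tailMass hV μ l _)
    refine Finset.sum_congr rfl fun a _ => ?_
    rw [← ih (append u a), ← one_mul (∫⁻ ω, tailMass V μ l (append u a) ω ∂P),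
      ← hmean ⟨k + 1, append u a⟩]
    exact lintegral_mul_eq_lintegral_mul_lintegral_of_indepFun (hV _)
      (measurable_tailMass hV μ l _) (indepFun_tailMass hV hind μ l _)

lemma lintegral_weight_append_rpow (hV : ∀ w, Measurable (V w)) (hind : iIndepFun V P)
    {q : ℝ} (hq : 0 ≤ q) {k : ℕ} (u : Fin k → Fin m) (a : Fin m) :
    ∫⁻ ω, weight V (append u a) ω ^ q ∂P =
      (∫⁻ ω, weight V u ω ^ q ∂P) * ∫⁻ ω, V ⟨k + 1, append u a⟩ ω ^ q ∂P := by
  simp_rw [weight_append]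
  exact lintegral_mul_rpow_of_indepFun (measurable_weight hV u) (hV _)
    (indepFun_weight hV hind u _) hq

/-- The sum over the words of length `k` of the `q`-th moments of the masses of the cylinders. -/
noncomputable def momentSum (V : Word m → Ω → ℝ≥0∞) (P : Measure Ω) (μ : Measure (ℕ → Fin m)) (q : ℝ)
    (k : ℕ) : ℝ≥0∞ :=
  ∑ u : Fin k → Fin m, (∫⁻ ω, weight V u ω ^ q ∂P) * μ (cylinder u) ^ q

/-- The sum over the words of length `k` of the `q`-th moments of the cascade `l` levels below. -/
noncomputable def tailMomentSum (V : Word m → Ω → ℝ≥0∞) (P : Measure Ω) (μ : Measure (ℕ → Fin m)) (q : ℝ)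
    (k l : ℕ) : ℝ≥0∞ :=
  ∑ u : Fin k → Fin m, (∫⁻ ω, weight V u ω ^ q ∂P) * ∫⁻ ω, tailMass V μ l u ω ^ q ∂P

lemma tailMomentSum_succ_le (hV : ∀ w, Measurable (V w)) (hind : iIndepFun V P)
    [IsProbabilityMeasure P] (hmean : ∀ w, ∫⁻ ω, V w ω ∂P = 1) (μ : Measure (ℕ → Fin m))
    {q : ℝ} (hq : 1 < q) {D : ℝ≥0} (hD : 1 < D) :
    ∃ C : ℝ≥0, ∀ k l, tailMomentSum V P μ q k (l + 1) ≤
      D * tailMomentSum V P μ q (k + 1) l + C * momentSum V P μ q k := by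
  -- The constant depends only on m, q and D, not on the vertex; hence one C serves all levels.
  obtain ⟨C, hC⟩ := exists_lintegral_sum_rpow_le (ι := Fin m) P hq hD
  have hq0 : 0 ≤ q := by linarith
  refine ⟨C, fun k l => ?_⟩
  have key : ∀ u : Fin k → Fin m, ∫⁻ ω, tailMass V μ (l + 1) u ω ^ q ∂P ≤
      D * ∑ a, (∫⁻ ω, V ⟨k + 1, append u a⟩ ω ^ q ∂P) *
        ∫⁻ ω, tailMass V μ l (append u a) ω ^ q ∂P + C * μ (cylinder u) ^ q := by
    intro u
    have h := hC (fun a ω => V ⟨k + 1, append u a⟩ ω * tailMass V μ l (append u a) ω)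
      (fun a => (hV _).mul (measurable_tailMass hV μ l _))
      (fun a b hab => indepFun_mul_tailMass hV hind μ l
        fun h => hab (append_injective u h)) (μ (cylinder u)) (fun a => ?_)
    · refine h.trans_eq ?_
      congr 3 with a
      exact lintegral_mul_rpow_of_indepFun (hV _) (measurable_tailMass hV μ l _)
        (indepFun_tailMass hV hind μ l _) hq0
    · have := lintegral_mul_eq_lintegral_mul_lintegral_of_indepFun (hV ⟨k + 1, append u a⟩)
        (measurable_tailMass hV μ l (append u a)) (indepFun_tailMass hV hind μ l (append u a))
      refine (this.trans ?_).trans_le (measure_cylinder_append_le μ u a)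
      rw [hmean, one_mul, lintegral_tailMass hV hind hmean]
  calc tailMomentSum V P μ q k (l + 1)
      ≤ ∑ u : Fin k → Fin m, (∫⁻ ω, weight V u ω ^ q ∂P) *
        (D * ∑ a, (∫⁻ ω, V ⟨k + 1, append u a⟩ ω ^ q ∂P) *
          ∫⁻ ω, tailMass V μ l (append u a) ω ^ q ∂P + C * μ (cylinder u) ^ q) := by
        unfold tailMomentSum
        gcongr with u
        exact key u
    _ = _ := by
        simp only [tailMomentSum, momentSum, sum_append, mul_add, Finset.sum_add_distrib,
          Finset.mul_sum, lintegral_weight_append_rpow hV hind hq0]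
        congr 1
        · refine Finset.sum_congr rfl fun u _ => Finset.sum_congr rfl fun a _ => ?_
          ring
        · exact Finset.sum_congr rfl fun u _ => by ring

lemma tailMomentSum_le (hV : ∀ w, Measurable (V w)) (hind : iIndepFun V P)
    [IsProbabilityMeasure P] (hmean : ∀ w, ∫⁻ ω, V w ω ∂P = 1) (μ : Measure (ℕ → Fin m))
    {q : ℝ} (hq : 1 < q) {D : ℝ≥0} (hD : 1 < D) :
    ∃ C : ℝ≥0, ∀ k l, tailMomentSum V P μ q k l ≤
      D ^ l * momentSum V P μ q (k + l) +
        C * ∑ i ∈ Finset.range l, (D : ℝ≥0∞) ^ i * momentSum V P μ q (k + i) := by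
  obtain ⟨C, hC⟩ := tailMomentSum_succ_le hV hind hmean μ hq hD
  refine ⟨C, fun k l => ?_⟩
  induction l generalizing k with
  | zero => simp [tailMomentSum, momentSum, tailMass]
  | succ l ih =>
    calc tailMomentSum V P μ q k (l + 1)
        ≤ D * tailMomentSum V P μ q (k + 1) l + C * momentSum V P μ q k := hC k l
      _ ≤ D * (D ^ l * momentSum V P μ q (k + 1 + l) + C * ∑ i ∈ Finset.range l,
            (D : ℝ≥0∞) ^ i * momentSum V P μ q (k + 1 + i)) + C * momentSum V P μ q k := by
          gcongr; exact ih (k + 1)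
      _ = _ := by
          rw [Finset.sum_range_succ']
          have h : ∀ i, k + 1 + i = k + (i + 1) := fun i => by omega
          simp only [h, mul_add, Finset.mul_sum, pow_zero, one_mul, add_zero, pow_succ]
          rw [add_assoc]
          congr 1
          · ring
          · congr 1
            exact Finset.sum_congr rfl fun i _ => by ring

/-- Carries finiteness from high levels down to low ones. It combines E(V^q) ≥ 1, which follows from
mean 1, with the power mean inequality over the m children. -/
lemma momentSum_le_succ (hV : ∀ w, Measurable (V w)) (hind : iIndepFun V P)
    [IsProbabilityMeasure P] (hmean : ∀ w, ∫⁻ ω, V w ω ∂P = 1) (μ : Measure (ℕ → Fin m))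
    {q : ℝ} (hq : 1 < q) (k : ℕ) :
    momentSum V P μ q k ≤ (m : ℝ≥0∞) ^ (q - 1) * momentSum V P μ q (k + 1) := by
  have hq0 : 0 < q := by linarith
  have h1 : ∀ w, 1 ≤ ∫⁻ ω, V w ω ^ q ∂P := by
    intro w
    have h := ENNReal.lintegral_mul_le_Lp_mul_Lq P (Real.HolderConjugate.conjExponent hq)
      (hV w).aemeasurable (g := fun _ => 1) aemeasurable_const
    simp only [Pi.mul_apply, mul_one, hmean w, ENNReal.one_rpow, lintegral_const, measure_univ] at h
    exact (ENNReal.one_rpow q ▸ ENNReal.rpow_le_rpow h hq0.le).trans_eq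
      (by rw [← ENNReal.rpow_mul, one_div_mul_cancel hq0.ne', ENNReal.rpow_one])
  unfold momentSum
  rw [sum_append, Finset.mul_sum]
  refine Finset.sum_le_sum fun u _ => ?_
  calc (∫⁻ ω, weight V u ω ^ q ∂P) * μ (cylinder u) ^ q
      ≤ (∫⁻ ω, weight V u ω ^ q ∂P) *
          ((m : ℝ≥0∞) ^ (q - 1) * ∑ a, μ (cylinder (append u a)) ^ q) := by
        gcongr
        rw [measure_cylinder_eq_sum]
        simpa using ENNReal.rpow_sum_le_const_mul_sum_rpow Finset.univ
          (fun a => μ (cylinder (append u a))) hq.le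
    _ = (m : ℝ≥0∞) ^ (q - 1) * ∑ a, (∫⁻ ω, weight V u ω ^ q ∂P) *
          μ (cylinder (append u a)) ^ q := by
        simp only [Finset.mul_sum]
        exact Finset.sum_congr rfl fun a _ => by ring
    _ ≤ _ := by
        refine mul_le_mul_right (Finset.sum_le_sum fun a _ => mul_le_mul_left ?_ _) _
        rw [lintegral_weight_append_rpow hV hind hq0.le]
        exact le_mul_of_one_le_right' (h1 _)

end Moments

end Cascade

/-! ### Root test with room for a factor D > 1. -/

lemma ENNReal.exists_tsum_pow_mul_lt_top {A : ℕ → ℝ≥0∞} (hA : ∀ k, A k ≠ ∞)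
    (hlim : limsup (fun k : ℕ => A k ^ (1 / (k : ℝ))) atTop < 1) :
    ∃ D : ℝ≥0, 1 < D ∧ ∑' k, (D : ℝ≥0∞) ^ k * A k < ∞ := by
  obtain ⟨r, hr, hr1⟩ := exists_between hlim
  lift r to ℝ≥0 using (hr1.trans ENNReal.one_lt_top).ne
  have hr0 : 0 < r := by exact_mod_cast (zero_le.trans_lt hr)
  have hr1 : r < 1 := by exact_mod_cast hr1
  -- Any D strictly between 1 and 1/r keeps the ratio D * r below 1.
  obtain ⟨D, hD, hDr⟩ := exists_between ((one_lt_inv₀ hr0).2 hr1)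
  have hDr1 : D * r < 1 := (lt_mul_inv_iff₀ hr0).1 (by rwa [one_mul])
  obtain ⟨N, hN⟩ := eventually_atTop.1 (eventually_lt_of_limsup_lt hr)
  -- The shift to N + 1 excludes k = 0, where the exponent 1/k is 0 and says nothing about A 0.
  have hle : ∀ k, N + 1 ≤ k → A k ≤ (r : ℝ≥0∞) ^ k := by
    intro k hk
    have hk0 : (k : ℝ) ≠ 0 := by
      have : k ≠ 0 := by omega
      exact_mod_cast this
    calc A k = (A k ^ (1 / (k : ℝ))) ^ (k : ℝ) := by
          rw [← ENNReal.rpow_mul, one_div_mul_cancel hk0, ENNReal.rpow_one]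
      _ ≤ (r : ℝ≥0∞) ^ (k : ℝ) :=
          ENNReal.rpow_le_rpow (hN k (by omega)).le (Nat.cast_nonneg k)
      _ = _ := ENNReal.rpow_natCast _ _
  refine ⟨D, hD, ?_⟩
  rw [← ENNReal.summable.sum_add_tsum_nat_add' (k := N + 1), ENNReal.add_lt_top]
  refine ⟨ENNReal.sum_lt_top.2 fun k _ =>
    ENNReal.mul_lt_top (ENNReal.pow_lt_top ENNReal.coe_lt_top) (hA k).lt_top, ?_⟩
  calc ∑' k, (D : ℝ≥0∞) ^ (k + (N + 1)) * A (k + (N + 1))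
      ≤ ∑' k, ((D * r : ℝ≥0) : ℝ≥0∞) ^ k := by
        refine ENNReal.tsum_le_tsum fun k => ?_
        calc (D : ℝ≥0∞) ^ (k + (N + 1)) * A (k + (N + 1))
            ≤ (D : ℝ≥0∞) ^ (k + (N + 1)) * (r : ℝ≥0∞) ^ (k + (N + 1)) := by
              gcongr; exact hle _ (by omega)
          _ = ((D * r : ℝ≥0) : ℝ≥0∞) ^ (k + (N + 1)) := by rw [ENNReal.coe_mul, mul_pow]
          _ ≤ _ := pow_le_pow_of_le_one zero_le (by exact_mod_cast hDr1.le) (by omega)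
    _ < ∞ := by
        rw [ENNReal.tsum_geometric, ENNReal.inv_lt_top, tsub_pos_iff_lt]
        exact_mod_cast hDr1

namespace Cascade

/-! ### Uniform bound for the q-th moments. -/

section Bounded

variable {m : ℕ} {Ω : Type*} [MeasurableSpace Ω] {P : Measure Ω} [IsProbabilityMeasure P]
  {V : Word m → Ω → ℝ≥0∞}

/-- The `q`-th moments of the total masses of the cascade are bounded. -/
lemma exists_lintegral_sum_weight_rpow_le (hV : ∀ w, Measurable (V w)) (hind : iIndepFun V P)
    (hmean : ∀ w, ∫⁻ ω, V w ω ∂P = 1) (μ : Measure (ℕ → Fin m)) {q : ℝ} (hq : 1 < q)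
    (hlim : limsup (fun k : ℕ => momentSum V P μ q k ^ (1 / (k : ℝ))) atTop < 1) :
    ∃ R : ℝ≥0, ∀ k : ℕ,
      ∫⁻ ω, (∑ u : Fin k → Fin m, weight V u ω * μ (cylinder u)) ^ q ∂P ≤ R := by
  -- The limsup controls only large k, while the final bound contains the sums of every level.
  have hfin : ∀ k, momentSum V P μ q k ≠ ∞ := by
    obtain ⟨N, hN⟩ := eventually_atTop.1 (eventually_lt_of_limsup_lt hlim)
    have hstep : ∀ k, momentSum V P μ q (k + 1) ≠ ∞ → momentSum V P μ q k ≠ ∞ := fun k hk =>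
      ((momentSum_le_succ hV hind hmean μ hq k).trans_lt (ENNReal.mul_lt_top
        (ENNReal.rpow_lt_top_of_nonneg (by linarith) (ENNReal.natCast_ne_top m)) hk.lt_top)).ne
    have hlarge : ∀ k, N + 1 ≤ k → momentSum V P μ q k ≠ ∞ := by
      intro k hk htop
      have h := hN k (by omega)
      have hk0 : 0 < 1 / (k : ℝ) := by
        have : 0 < k := by omega
        positivity
      rw [htop, ENNReal.top_rpow_of_pos hk0] at h
      exact not_top_lt h
    intro k
    rcases le_total (N + 1) k with h | h
    · exact hlarge k h
    · exact Nat.decreasingInduction (motive := fun k _ => momentSum V P μ q k ≠ ∞)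
        (fun k _ ih => hstep k ih) (hlarge _ le_rfl) h
  obtain ⟨D, hD, hsum⟩ := ENNReal.exists_tsum_pow_mul_lt_top hfin hlim
  obtain ⟨C, hC⟩ := tailMomentSum_le hV hind hmean μ hq hD
  have hR : (1 + C) * ∑' k, (D : ℝ≥0∞) ^ k * momentSum V P μ q k ≠ ∞ :=
    ENNReal.mul_ne_top (by simp) hsum.ne
  lift (1 + C) * ∑' k, (D : ℝ≥0∞) ^ k * momentSum V P μ q k to ℝ≥0 using hR with R hRe
  refine ⟨R, fun k => ?_⟩
  calc ∫⁻ ω, (∑ u : Fin k → Fin m, weight V u ω * μ (cylinder u)) ^ q ∂P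
      = tailMomentSum V P μ q 0 k := by
        -- The split is made at level 0, where the only word is empty and has weight 1.
        simp_rw [← sum_weight_mul_tailMass V μ (zero_add k)]
        simp [tailMomentSum, weight]
    _ ≤ D ^ k * momentSum V P μ q (0 + k) +
        C * ∑ i ∈ Finset.range k, (D : ℝ≥0∞) ^ i * momentSum V P μ q (0 + i) := hC 0 k
    _ ≤ ∑' k, (D : ℝ≥0∞) ^ k * momentSum V P μ q k +
        C * ∑' k, (D : ℝ≥0∞) ^ k * momentSum V P μ q k := by
        simp_rw [zero_add]
        gcongr
        · exact ENNReal.le_tsum (f := fun k => (D : ℝ≥0∞) ^ k * momentSum V P μ q k) k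
        · exact ENNReal.sum_le_tsum _
    _ = R := by rw [hRe, add_mul, one_mul]

end Bounded

/-! ### The real-valued cascade and its martingale property. -/

section RealCascade

variable {m : ℕ} {Ω : Type*}

lemma totalMass_eq_cylinderSum (W : Word m → Ω → ℝ) (μ : Measure (ℕ → Fin m))
    [IsProbabilityMeasure μ] (k : ℕ) (ω : Ω) : totalMass W μ k ω = cylinderSum W μ k ω :=
  integral_curtail μ fun u => X W u ω

lemma X_append (W : Word m → Ω → ℝ) {k : ℕ} (u : Fin k → Fin m) (a : Fin m) :
    X W (append u a) = X W u * W ⟨k + 1, append u a⟩ :=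
  funext fun ω => prod_append (fun w => W w ω) u a

variable [mΩ : MeasurableSpace Ω] {P : Measure Ω} {W : Word m → Ω → ℝ}

lemma measurable_X_filtration (hW : ∀ w, Measurable (W w)) {k : ℕ} (u : Fin k → Fin m) :
    Measurable[filtration W hW k] (X W u) := by
  refine Finset.measurable_prod _ fun r _ => ?_
  have hr : (⟨r + 1, curtailWord u (r + 1) r.isLt⟩ : Word m) ∈ {w : Word m | w.1 ≤ k} := r.isLt
  exact (comap_measurable (W ⟨r + 1, curtailWord u (r + 1) r.isLt⟩)).mono
    (le_biSup (fun w => MeasurableSpace.comap (W w) inferInstance) hr) le_rfl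

lemma indep_filtration (hW : ∀ w, Measurable (W w)) (hind : iIndepFun W P) {k : ℕ}
    (v : Fin (k + 1) → Fin m) :
    Indep (filtration W hW k) (MeasurableSpace.comap (W ⟨k + 1, v⟩) inferInstance) P :=
  indep_iSup_comap_of_length_le hW hind v

lemma ae_X_nonneg (hpos : ∀ w, ∀ᵐ ω ∂P, 0 < W w ω) :
    ∀ᵐ ω ∂P, ∀ (k : ℕ) (u : Fin k → Fin m), 0 ≤ X W u ω ∧
      weight (fun w ω => ENNReal.ofReal (W w ω)) u ω = ENNReal.ofReal (X W u ω) := by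
  filter_upwards [ae_all_iff.2 hpos] with ω hω k u
  exact ⟨Finset.prod_nonneg fun r _ => (hω _).le,
    (ENNReal.ofReal_prod_of_nonneg fun r _ => (hω _).le).symm⟩

variable [IsProbabilityMeasure P]

lemma integrable_X (hW : ∀ w, Measurable (W w)) (hind : iIndepFun W P)
    (hint : ∀ w, Integrable (W w) P) {k : ℕ} (u : Fin k → Fin m) : Integrable (X W u) P := by
  induction k with
  | zero =>
    have : X W u = fun _ => 1 := by funext ω; simp [X]
    rw [this]
    exact integrable_const 1
  | succ k ih =>
    obtain ⟨v, a, rfl⟩ : ∃ v a, append v a = u :=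
      ⟨Fin.init u, u (Fin.last k), Fin.snoc_init_self (α := fun _ => Fin m) u⟩
    rw [X_append]
    exact IndepFun.integrable_mul (indep_of_indep_of_le_left (indep_filtration hW hind _)
      (measurable_X_filtration hW v).comap_le) (ih v) (hint _)

/-- The factor X_u is known at level k and comes out; the new weight is independent of that level
and has mean 1. -/
lemma condExp_X_append (hW : ∀ w, Measurable (W w)) (hind : iIndepFun W P)
    (hint : ∀ w, Integrable (W w) P) (hmean : ∀ w, ∫ ω, W w ω ∂P = 1) {k : ℕ}
    (u : Fin k → Fin m) (a : Fin m) :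
    P[X W (append u a) | filtration W hW k] =ᵐ[P] X W u := by
  have hXW := integrable_X hW hind hint (append u a)
  rw [X_append] at hXW ⊢
  have h1 := condExp_mul_of_stronglyMeasurable_left
    (measurable_X_filtration hW u).stronglyMeasurable hXW (hint ⟨k + 1, append u a⟩)
  have h2 := condExp_indep_eq (μ := P) (hW ⟨k + 1, append u a⟩).comap_le
    ((filtration W hW).le k)
    (comap_measurable (W ⟨k + 1, append u a⟩)).stronglyMeasurable
    (indep_filtration hW hind (append u a)).symm
  filter_upwards [h1, h2] with ω h1 h2
  rw [h1, Pi.mul_apply, h2, hmean, mul_one]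

lemma martingale_totalMass (hW : ∀ w, Measurable (W w)) (hind : iIndepFun W P)
    (hint : ∀ w, Integrable (W w) P) (hmean : ∀ w, ∫ ω, W w ω ∂P = 1)
    (μ : Measure (ℕ → Fin m)) [IsProbabilityMeasure μ] :
    Martingale (totalMass W μ) (filtration W hW) P := by
  have htot : ∀ k, totalMass W μ k =
      ∑ u : Fin k → Fin m, μ.real (cylinder u) • X W u := by
    intro k
    funext ω
    rw [totalMass_eq_cylinderSum, Finset.sum_apply]
    exact Finset.sum_congr rfl fun u _ => mul_comm _ _
  have hreal : ∀ {k : ℕ} (u : Fin k → Fin m),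
      μ.real (cylinder u) = ∑ a, μ.real (cylinder (append u a)) := by
    intro k u
    simp only [measureReal_def]
    rw [measure_cylinder_eq_sum, ENNReal.toReal_sum fun a _ => measure_ne_top _ _]
  refine martingale_nat (fun k => ?_) (fun k => ?_) fun k => ?_
  · rw [htot]
    exact Finset.stronglyMeasurable_sum _ fun u _ =>
      (measurable_X_filtration hW u).stronglyMeasurable.const_smul _
  · rw [htot]
    exact integrable_finsetSum' _ fun u _ => (integrable_X hW hind hint u).smul _
  -- Writing the parent of v as `Fin.init v` gives a finite family of almost sure equalities indexed
  -- by v, to be summed over all children.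
  · have hce : ∀ v : Fin (k + 1) → Fin m, P[μ.real (cylinder v) • X W v | filtration W hW k]
        =ᵐ[P] μ.real (cylinder v) • X W (Fin.init (α := fun _ => Fin m) v) := by
      intro v
      obtain ⟨u, a, rfl⟩ : ∃ u a, append u a = v :=
        ⟨Fin.init v, v (Fin.last k), Fin.snoc_init_self (α := fun _ => Fin m) v⟩
      have hu : Fin.init (α := fun _ => Fin m) (append u a) = u :=
        Fin.init_snoc (α := fun _ => Fin m) a u
      rw [hu]
      exact (condExp_smul _ _ _).trans
        ((condExp_X_append hW hind hint hmean u a).const_smul _)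
    have hsum := condExp_finsetSum (m := filtration W hW k)
      (fun v (_ : v ∈ (Finset.univ : Finset (Fin (k + 1) → Fin m))) =>
        (integrable_X hW hind hint v).smul (μ.real (cylinder v)))
    rw [htot (k + 1)]
    filter_upwards [hsum, ae_all_iff.2 hce] with ω h1 h2
    rw [h1, htot, Finset.sum_apply, Finset.sum_apply, Finset.sum_congr rfl fun v _ => h2 v,
      sum_append]
    refine Finset.sum_congr rfl fun u _ => ?_
    rw [hreal]
    simp only [Pi.smul_apply, smul_eq_mul, Finset.sum_mul]
    refine Finset.sum_congr rfl fun a _ => ?_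
    rw [show Fin.init (α := fun _ => Fin m) (append u a) = u from
      Fin.init_snoc (α := fun _ => Fin m) a u]

end RealCascade

end Cascade

/-! ### Assembly of the theorem. -/

theorem theorem1p1 {Ω : Type*} [MeasurableSpace Ω] (P : Measure Ω) [IsProbabilityMeasure P]
    (m : ℕ) (W : Cascade.Word m → Ω → ℝ)
    (hW_meas : ∀ i, Measurable (W i))
    (hW_indep : iIndepFun W P)
    (hW_pos : ∀ i, ∀ᵐ ω ∂P, 0 < W i ω)
    (hW_int : ∀ i, Integrable (W i) P)
    (hW_mean : ∀ i, ∫ ω, W i ω ∂P = 1)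
    (μ : Measure (ℕ → Fin m)) [IsProbabilityMeasure μ]
    (q : ℝ) (hq : 1 < q)
    (hcond : limsup (fun k : ℕ =>
      (∑ i : Fin k → Fin m,
        Cascade.moment P q (fun ω => Cascade.X W i ω * μ.real (Cascade.cylinder i)))
          ^ (1 / (k : ℝ))) atTop < 1) :
    (∀ k ω, Cascade.totalMass W μ k ω = Cascade.cylinderSum W μ k ω) ∧
    Martingale (Cascade.totalMass W μ) (Cascade.filtration W hW_meas) P ∧
    limsup (fun k : ℕ => Cascade.moment P q (Cascade.totalMass W μ k)) atTop =
      limsup (fun k : ℕ => Cascade.moment P q (Cascade.cylinderSum W μ k)) atTop ∧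
    limsup (fun k : ℕ => Cascade.moment P q (Cascade.cylinderSum W μ k)) atTop < ⊤ ∧
    (⨆ k : ℕ, Cascade.moment P q (Cascade.totalMass W μ k)) < ⊤ ∧
    ∃ Z : Ω → ℝ, MemLp Z (ENNReal.ofReal q) P ∧
      (∀ᵐ ω ∂P, Tendsto (fun k : ℕ => Cascade.totalMass W μ k ω) atTop (𝓝 (Z ω))) ∧
      Tendsto (fun k : ℕ =>
        eLpNorm (fun ω => Cascade.totalMass W μ k ω - Z ω) (ENNReal.ofReal q) P) atTop (𝓝 0) := by
  have hq0 : 0 < q := by linarith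
  have heq : ∀ k, Cascade.totalMass W μ k = Cascade.cylinderSum W μ k := fun k =>
    funext fun ω => Cascade.totalMass_eq_cylinderSum W μ k ω
  have hmart := Cascade.martingale_totalMass hW_meas hW_indep hW_int hW_mean μ
  -- The moment estimates run in `ℝ≥0∞`, where no integrability is needed; almost sure positivity
  -- makes the passage lossless.
  set V : Cascade.Word m → Ω → ℝ≥0∞ := fun w ω => ENNReal.ofReal (W w ω) with hVdef
  have hV : ∀ w, Measurable (V w) := fun w => (hW_meas w).ennreal_ofReal
  have hind : iIndepFun V P :=
    hW_indep.comp (fun _ => ENNReal.ofReal) fun _ => ENNReal.measurable_ofReal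
  have hmean : ∀ w, ∫⁻ ω, V w ω ∂P = 1 := fun w => by
    rw [← ofReal_integral_eq_lintegral_ofReal (hW_int w)
      ((hW_pos w).mono fun ω h => h.le), hW_mean, ENNReal.ofReal_one]
  have hX := Cascade.ae_X_nonneg hW_pos
  have hmom : ∀ k, ∑ i : Fin k → Fin m,
      Cascade.moment P q (fun ω => Cascade.X W i ω * μ.real (Cascade.cylinder i)) =
        Cascade.momentSum V P μ q k := by
    intro k
    refine Finset.sum_congr rfl fun u _ => ?_
    rw [← lintegral_mul_const _ ((Cascade.measurable_weight hV u).pow_const q)]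
    refine lintegral_congr_ae ?_
    filter_upwards [hX] with ω hω
    rw [(hω k u).2, ← ENNReal.mul_rpow_of_nonneg _ _ hq0.le,
      ← ENNReal.ofReal_rpow_of_nonneg (mul_nonneg (hω k u).1 measureReal_nonneg) hq0.le,
      ENNReal.ofReal_mul (hω k u).1, ofReal_measureReal]
  simp_rw [hmom] at hcond
  obtain ⟨R, hR⟩ :=
    Cascade.exists_lintegral_sum_weight_rpow_le hV hind hmean μ hq hcond
  have hnn : ∀ᵐ ω ∂P, ∀ k, 0 ≤ Cascade.cylinderSum W μ k ω := by
    filter_upwards [hX] with ω hω k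
    exact Finset.sum_nonneg fun u _ => mul_nonneg (hω k u).1 measureReal_nonneg
  have hmomR : ∀ k, Cascade.moment P q (Cascade.cylinderSum W μ k) ≤ R := by
    intro k
    refine (lintegral_congr_ae ?_).trans_le (hR k)
    filter_upwards [hX, hnn] with ω hω hnn
    rw [← ENNReal.ofReal_rpow_of_nonneg (hnn k) hq0.le, Cascade.cylinderSum,
      ENNReal.ofReal_sum_of_nonneg fun u _ => mul_nonneg (hω k u).1 measureReal_nonneg]
    congr 1
    refine Finset.sum_congr rfl fun u _ => ?_
    rw [(hω k u).2, ENNReal.ofReal_mul (hω k u).1, ofReal_measureReal]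
  have hLp : ∀ k, eLpNorm (Cascade.totalMass W μ k) (ENNReal.ofReal q) P ≤
      (R ^ (1 / q) : ℝ≥0) := by
    intro k
    rw [heq, eLpNorm_eq_lintegral_rpow_enorm_toReal (by simpa using hq0) ENNReal.ofReal_ne_top,
      ENNReal.toReal_ofReal hq0.le, ENNReal.coe_rpow_of_nonneg _ (by positivity)]
    refine ENNReal.rpow_le_rpow (le_trans (le_of_eq ?_) (hmomR k)) (by positivity)
    refine lintegral_congr_ae ?_
    filter_upwards [hnn] with ω hω
    rw [Real.enorm_of_nonneg (hω k), ENNReal.ofReal_rpow_of_nonneg (hω k) hq0.le]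
  obtain ⟨Z, hZ, hae, hconv⟩ := hmart.exists_tendsto_of_eLpNorm_bdd
    (by simpa using hq) ENNReal.ofReal_ne_top hLp
  have heq' : Cascade.totalMass W μ = Cascade.cylinderSum W μ := funext heq
  rw [heq'] at hmart hae hconv ⊢
  exact ⟨fun _ _ => rfl, hmart, rfl,
    (limsup_le_of_le (h := Eventually.of_forall hmomR)).trans_lt ENNReal.coe_lt_top,
    (iSup_le hmomR).trans_lt ENNReal.coe_lt_top, Z, hZ, hae, hconv⟩
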